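/- An abstract simplicial complex is a set of nonempty finite sets (its simplices) that is closed under taking nonempty subsets; its vertices are the elements of its simplices, and $|K|$ denotes the geometric realization of $K$. For a vertex $x$ of $K$, the closed star $\overline{St(x)}$ is the subcomplex consisting of all simplices of $K$ that are contained in some simplex of $K$ having $x$ as a vertex. For a vertex $z$ and a complex $L$ not containing $z$ as a vertex, the simplicial cone is $z * L = \{\{z\}\} \cup L \cup \{\{z\} \cup \tau \mid \tau \in L\}$. For a set $A$ of vertices, $K \setminus A$ is the subcomplex of all simplices of $K$ having no vertex in $A$. **Theorem.** Let $K$ be a finite simplicial complex, let $A = \{x_1, \ldots, x_n\}$ be a finite set of vertices of $K$, let $L = \bigcup_{i=1}^n \overline{St(x_i)}$, and let $z$ be a new vertex, that is, not a vertex of $K$. Put $K' = K \cup (z * L)$ and $K'' = K' \setminus A$. If $|L|$ is contractible, then $|K|$, $|K'|$ and $|K''|$ are pairwise homotopy equivalent. -/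

import Mathlib

/- Mathlib's `PreAbstractSimplicialComplex V` is a set of nonempty finite subsets of `V` closed
under taking nonempty subsets; points of `V` need not be vertices. -/
namespace PreAbstractSimplicialComplex

variable {V : Type*}

/-- The geometric realization: the union, over the simplices `s` of `K`, of the closed geometric
simplices spanned by the unit vectors of `ℝ^V` indexed by `s`. A point is a system of barycentric
coordinates. The topology is the one induced from the product topology of `V → ℝ`; for a complex
with finitely many simplices it is the weak topology with respect to the closed simplices. -/
def realization (K : PreAbstractSimplicialComplex V) : Set (V → ℝ) :=
  {f | ∃ s ∈ K.faces, (∀ v, 0 ≤ f v) ∧ (∀ v, v ∉ s → f v = 0) ∧ ∑ v ∈ s, f v = 1}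

/-- The (open) star of `σ`: the simplices of `K` having `σ` as a face. -/
def starOf (K : PreAbstractSimplicialComplex V) (σ : Finset V) : Set (Finset V) :=
  {τ | τ ∈ K.faces ∧ σ ⊆ τ}

/-- The combinatorial closure of a set `S` of simplices of `K`: all simplices of `K` that are
faces of some member of `S`. -/
def combClosure (K : PreAbstractSimplicialComplex V) (S : Set (Finset V)) :
    PreAbstractSimplicialComplex V where
  faces := {σ | σ ∈ K.faces ∧ ∃ τ ∈ S, σ ⊆ τ}
  isRelLowerSet_faces := by
    rintro σ ⟨hσ, τ, hτ, hστ⟩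
    refine ⟨(K.isRelLowerSet_faces hσ).1, fun ρ hρ hne => ?_⟩
    exact ⟨(K.isRelLowerSet_faces hσ).2 hρ hne, τ, hτ, Finset.Subset.trans hρ hστ⟩

/-- The subcomplex `⋃_{x ∈ A}` (closed star of `x` in `K`). -/
def closedStars (K : PreAbstractSimplicialComplex V) (A : Finset V) :
    PreAbstractSimplicialComplex V :=
  ⨆ x ∈ A, K.combClosure (K.starOf {x})

/-- The complex with the single vertex `z`. -/
def point (z : V) : PreAbstractSimplicialComplex V where
  faces := {{z}}
  isRelLowerSet_faces := by
    rintro σ hσ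
    rw [Set.mem_singleton_iff] at hσ
    subst hσ
    exact ⟨Finset.singleton_nonempty z, fun ρ hρ hne =>
      (Finset.Nonempty.subset_singleton_iff hne).1 hρ⟩

/-- The simplicial join `K * L = K ∪ L ∪ {σ ∪ τ | σ ∈ K, τ ∈ L}` of two complexes
(with disjoint vertex sets). -/
def join [DecidableEq V] (K L : PreAbstractSimplicialComplex V) :
    PreAbstractSimplicialComplex V where
  faces := K.faces ∪ L.faces ∪ {ρ | ∃ σ ∈ K.faces, ∃ τ ∈ L.faces, ρ = σ ∪ τ}
  isRelLowerSet_faces := by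
    rintro ρ ((h | h) | ⟨σ, hσ, τ, hτ, rfl⟩)
    · exact ⟨(K.isRelLowerSet_faces h).1, fun π hπ hne =>
        Or.inl (Or.inl ((K.isRelLowerSet_faces h).2 hπ hne))⟩
    · exact ⟨(L.isRelLowerSet_faces h).1, fun π hπ hne =>
        Or.inl (Or.inr ((L.isRelLowerSet_faces h).2 hπ hne))⟩
    · refine ⟨(K.isRelLowerSet_faces hσ).1.mono Finset.subset_union_left, fun π hπ hne => ?_⟩
      have hdec : π = (π ∩ σ) ∪ (π ∩ τ) := by
        rw [← Finset.inter_union_distrib_left]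
        exact (Finset.inter_eq_left.2 hπ).symm
      by_cases h1 : (π ∩ σ).Nonempty
      · have m1 : π ∩ σ ∈ K.faces := (K.isRelLowerSet_faces hσ).2 Finset.inter_subset_right h1
        by_cases h2 : (π ∩ τ).Nonempty
        · exact Or.inr ⟨_, m1, _,
            (L.isRelLowerSet_faces hτ).2 Finset.inter_subset_right h2, hdec⟩
        · rw [Finset.not_nonempty_iff_eq_empty] at h2
          rw [h2, Finset.union_empty] at hdec
          exact Or.inl (Or.inl (hdec ▸ m1))
      · rw [Finset.not_nonempty_iff_eq_empty] at h1
        rw [h1, Finset.empty_union] at hdec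
        have hτ' : π ⊆ τ := Finset.inter_eq_left.1 hdec.symm
        exact Or.inl (Or.inr ((L.isRelLowerSet_faces hτ).2 hτ' hne))

/-- `K' = K ∪ (z * L)`, where `L` is the union of the closed stars in `K` of the vertices in `A`. -/
def addCone [DecidableEq V] (K : PreAbstractSimplicialComplex V) (A : Finset V) (z : V) :
    PreAbstractSimplicialComplex V :=
  K ⊔ (point z).join (K.closedStars A)

/-- `K \ A`: delete the vertices in `A`, keeping the simplices without vertex in `A`. -/
def deleteVertices (K : PreAbstractSimplicialComplex V) (A : Finset V) :
    PreAbstractSimplicialComplex V where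
  faces := {σ | σ ∈ K.faces ∧ ∀ v ∈ σ, v ∉ A}
  isRelLowerSet_faces := by
    rintro σ ⟨hσ, hA⟩
    exact ⟨(K.isRelLowerSet_faces hσ).1, fun ρ hρ hne =>
      ⟨(K.isRelLowerSet_faces hσ).2 hρ hne, fun v hv => hA v (hρ hv)⟩⟩

end PreAbstractSimplicialComplex

/-!
The two homotopy equivalences have different reasons.

*Attaching a cone.* `K'` is obtained from `K` by gluing a cone with apex `z` onto the subcomplex
`L`, and `|L|` has a contraction `H`, ending at a point. Write a point of the cone as `(y, t)`
with `y ∈ |L|` and `t` the barycentric coordinate of `z`. Then `(y, t) ↦ H t y` on the cone,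
together with the identity of `|K|`, is a retraction of `|K'|` onto `|K|`, well defined at the apex
because `H 1` is constant. The inclusion after this retraction is homotopic to the identity through
the maps `(y, t) ↦ (H a y, b)`, where `(a, b)` runs from `(0, t)` over `(t, t)` to `(t, 0)`. At the
apex, `t = 1`, this path stays on the edges `b = 1` and `a = 1`, where `(H a y, b)` does not depend
on `y`. This avoids the homotopy extension property; continuity only needs that a continuous
surjection from a compact space to a Hausdorff space is a quotient map. The topological form is
`ContinuousMap.HomotopyEquiv.nonempty_of_cone_attached`, its application to complexes is
`PreAbstractSimplicialComplex.nonempty_homotopyEquiv_sup_cone`.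

*Deleting vertices.* In `K'` every vertex of `A` is dominated by `z`: a simplex having a vertex in
`A` stays a simplex when `z` is added to it. Hence the simplicial map sending all of `A` to `z` and
fixing the other vertices is a retraction of `|K'|` onto `|K''|`, homotopic to the identity
along straight lines: `PreAbstractSimplicialComplex.nonempty_homotopyEquiv_deleteVertices`.
-/

open unitInterval

/-! ### Attaching a cone on a contractible space -/

/-- Let `X` be the union of a copy `i` of `K` and a cone `c` on `L`, where the base `t = 0` of the
cone is glued to `K` along `j` and there are no other identifications. If `L` is contractible,
then `K` and `X` are homotopy equivalent. -/
theorem ContinuousMap.HomotopyEquiv.nonempty_of_cone_attached {K L X : Type*}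
    [TopologicalSpace K] [TopologicalSpace L] [TopologicalSpace X]
    [CompactSpace K] [CompactSpace L] [T2Space X] [ContractibleSpace L]
    (i : C(K, X)) (j : C(L, K)) (c : C(L × I, X))
    (hi : Function.Injective i)
    (hc_zero : ∀ y, c (y, 0) = i (j y))
    (hc_one : ∀ y y', c (y, 1) = c (y', 1))
    (hsurj : ∀ x, (∃ k, i k = x) ∨ ∃ p, c p = x)
    (hic : ∀ k y t, i k = c (y, t) → t = 0)
    (hcc : ∀ y t y' t', c (y, t) = c (y', t') → t = t' ∧ (t = 1 ∨ y = y')) :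
    Nonempty (ContinuousMap.HomotopyEquiv K X) := by
  obtain ⟨p, ⟨H⟩⟩ := id_nullhomotopic L
  have hic' : ∀ k y t, i k = c (y, t) → t = 0 ∧ k = j y := fun k y t h => by
    obtain rfl := hic k y t h
    exact ⟨rfl, hi (h.trans (hc_zero y))⟩
  let q : C(K ⊕ L × I, X) := ⟨Sum.elim i c, by fun_prop⟩
  have hq : Topology.IsQuotientMap q := by
    refine q.continuous.isClosedMap.isQuotientMap q.continuous fun x => ?_
    rcases hsurj x with ⟨k, hk⟩ | ⟨p, hp⟩
    · exact ⟨.inl k, hk⟩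
    · exact ⟨.inr p, hp⟩
  let r₀ : C(K ⊕ L × I, K) := ⟨Sum.elim id fun p => j (H (p.2, p.1)), by fun_prop⟩
  have hr₀ : Function.FactorsThrough r₀ q := by
    rintro (k | ⟨y, t⟩) (k' | ⟨y', t'⟩) h
    · exact hi h
    · obtain ⟨rfl, rfl⟩ := hic' k y' t' h
      exact congrArg j (H.apply_zero y').symm
    · obtain ⟨rfl, rfl⟩ := hic' k' y t h.symm
      exact congrArg j (H.apply_zero y)
    · obtain ⟨rfl, rfl | rfl⟩ := hcc y t y' t' h
      · exact congrArg j ((H.apply_one y).trans (H.apply_one y').symm)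
      · rfl
  let r : C(X, K) := hq.lift r₀ hr₀
  have hr : ∀ w, r (q w) = r₀ w := fun w => congrArg (· w) (hq.lift_comp r₀ hr₀)
  have hri : ∀ k, r (i k) = k := fun k => hr (.inl k)
  have hrc : ∀ y t, r (c (y, t)) = j (H (t, y)) := fun y t => hr (.inr (y, t))
  -- `u` rises from `0` to `1` on the first half of the interval, `v` falls on the second half.
  let u : I → I := fun s => Set.projIcc 0 1 zero_le_one (2 * (s : ℝ))
  let v : I → I := fun s => Set.projIcc 0 1 zero_le_one (2 - 2 * (s : ℝ))
  have hu : Continuous u := continuous_projIcc.comp (by fun_prop)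
  have hv : Continuous v := continuous_projIcc.comp (by fun_prop)
  have u_zero : u 0 = 0 := Set.projIcc_of_le_left _ (by simp)
  have u_one : u 1 = 1 := Set.projIcc_of_right_le _ (by simp)
  have v_zero : v 0 = 1 := Set.projIcc_of_right_le _ (by simp)
  have v_one : v 1 = 0 := Set.projIcc_of_le_left _ (by simp)
  have huv : ∀ s, u s = 1 ∨ v s = 1 := fun s => by
    rcases le_total (1 / 2 : ℝ) s with h | h
    · exact .inl (Set.projIcc_of_right_le _ (by linarith))
    · exact .inr (Set.projIcc_of_right_le _ (by linarith))
  -- `Q` is `id × q`, with the product distributed over the sum.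
  let Q : C((I × K) ⊕ I × L × I, I × X) := ⟨Sum.elim (Prod.map id i) (Prod.map id c), by fun_prop⟩
  have hQ : Topology.IsQuotientMap Q := by
    refine Q.continuous.isClosedMap.isQuotientMap Q.continuous fun ⟨s, x⟩ => ?_
    rcases hsurj x with ⟨k, hk⟩ | ⟨p, hp⟩
    · exact ⟨.inl (s, k), Prod.ext rfl hk⟩
    · exact ⟨.inr (s, p), Prod.ext rfl hp⟩
  let G₀ : C((I × K) ⊕ I × L × I, X) :=
    ⟨Sum.elim (fun w => i w.2) (fun w => c (H (w.2.2 * u w.1, w.2.1), w.2.2 * v w.1)), by fun_prop⟩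
  have hG₀ : Function.FactorsThrough G₀ Q := by
    have key : ∀ s y, G₀ (.inr (s, y, 0)) = i (j y) := fun s y => by
      change c (H (0 * u s, y), 0 * v s) = _
      simp [hc_zero]
    rintro (⟨s, k⟩ | ⟨s, y, t⟩) (⟨s', k'⟩ | ⟨s', y', t'⟩) h
    · exact (Prod.ext_iff.1 h).2
    · obtain ⟨rfl, rfl⟩ := hic' k y' t' (Prod.ext_iff.1 h).2
      exact (key s' y').symm
    · obtain ⟨rfl, rfl⟩ := hic' k' y t (Prod.ext_iff.1 h).2.symm
      exact key s y
    · obtain rfl : s = s' := (Prod.ext_iff.1 h).1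
      obtain ⟨rfl, rfl | rfl⟩ := hcc y t y' t' (Prod.ext_iff.1 h).2
      · change c (H (1 * u s, y), 1 * v s) = c (H (1 * u s, y'), 1 * v s)
        rcases huv s with h | h
        · simp [h]
        · rw [h]; simpa using hc_one _ _
      · rfl
  let G : C(I × X, X) := hQ.lift G₀ hG₀
  have hG : ∀ w, G (Q w) = G₀ w := fun w => congrArg (· w) (hQ.lift_comp G₀ hG₀)
  have hGi : ∀ s k, G (s, i k) = i k := fun s k => hG (.inl (s, k))
  have hGc : ∀ s y t, G (s, c (y, t)) = c (H (t * u s, y), t * v s) :=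
    fun s y t => hG (.inr (s, y, t))
  have hom : (ContinuousMap.id X).Homotopic (i.comp r) := by
    refine ⟨⟨G, fun x => ?_, fun x => ?_⟩⟩
    · rcases hsurj x with ⟨k, rfl⟩ | ⟨⟨y, t⟩, rfl⟩
      · exact hGi 0 k
      · refine (hGc 0 y t).trans ?_
        simp [u_zero, v_zero]
    · rcases hsurj x with ⟨k, rfl⟩ | ⟨⟨y, t⟩, rfl⟩
      · refine (hGi 1 k).trans ?_
        simp [hri]
      · refine (hGc 1 y t).trans ?_
        simp [u_one, v_one, hc_zero, hrc]
  refine ⟨⟨i, r, ?_, hom.symm⟩⟩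
  have : r.comp i = ContinuousMap.id K := ContinuousMap.ext hri
  rw [this]

namespace PreAbstractSimplicialComplex

variable {V : Type*}

/-! ### Geometric realizations -/

theorem realization_mono {K L : PreAbstractSimplicialComplex V} (h : K ≤ L) :
    K.realization ⊆ L.realization :=
  fun _ ⟨s, hs, hf⟩ => ⟨s, h hs, hf⟩

theorem realization_sup (K L : PreAbstractSimplicialComplex V) :
    (K ⊔ L).realization = K.realization ∪ L.realization := by
  ext f
  constructor
  · rintro ⟨s, hs | hs, hf⟩
    · exact .inl ⟨s, hs, hf⟩
    · exact .inr ⟨s, hs, hf⟩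
  · rintro (⟨s, hs, hf⟩ | ⟨s, hs, hf⟩)
    · exact ⟨s, .inl hs, hf⟩
    · exact ⟨s, .inr hs, hf⟩

theorem compactSpace_realization {K : PreAbstractSimplicialComplex V} (hK : K.faces.Finite) :
    CompactSpace K.realization := by
  rw [← isCompact_iff_compactSpace]
  have : K.realization =
      ⋃ s ∈ K.faces, {f | (∀ v, 0 ≤ f v) ∧ (∀ v, v ∉ s → f v = 0) ∧ ∑ v ∈ s, f v = 1} := by
    ext f
    simp only [realization, Set.mem_ofPred_eq, Set.mem_iUnion, exists_prop]
  rw [this]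
  refine hK.isCompact_biUnion fun s _ => ?_
  refine (isCompact_univ_pi fun _ : V => isCompact_Icc (a := (0 : ℝ)) (b := 1)).of_isClosed_subset
    ?_ ?_
  · simp only [Set.ofPred_and, Set.ofPred_forall]
    refine (isClosed_iInter fun v => ?_).inter ((isClosed_iInter fun v => isClosed_iInter fun _ =>
      ?_).inter ?_)
    · exact isClosed_le (by fun_prop) (by fun_prop)
    · exact isClosed_eq (by fun_prop) (by fun_prop)
    · exact isClosed_eq (by fun_prop) (by fun_prop)
  · rintro f ⟨h0, hs, h1⟩ v -
    refine ⟨h0 v, ?_⟩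
    by_cases hv : v ∈ s
    · exact h1 ▸ Finset.single_le_sum (fun w _ => h0 w) hv
    · simp [hs v hv]

theorem apply_eq_zero_of_mem_realization {K : PreAbstractSimplicialComplex V} {f : V → ℝ}
    (hf : f ∈ K.realization) {z : V} (hz : {z} ∉ K.faces) : f z = 0 := by
  obtain ⟨s, hs, -, h, -⟩ := hf
  exact h z fun hzs => hz <| (K.isRelLowerSet_faces hs).2 (Finset.singleton_subset_iff.2 hzs)
    (Finset.singleton_nonempty z)

/-! ### The union of the stars of a set of vertices -/

theorem mem_faces_iSup {ι : Sort*} {F : ι → PreAbstractSimplicialComplex V} {s : Finset V} :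
    s ∈ (⨆ i, F i).faces ↔ ∃ i, s ∈ (F i).faces := by
  change s ∈ ⋃ K ∈ Set.range F, K.faces ↔ _
  simp

theorem mem_faces_closedStars {K : PreAbstractSimplicialComplex V} {A : Finset V} {s : Finset V} :
    s ∈ (K.closedStars A).faces ↔ s ∈ K.faces ∧ ∃ x ∈ A, ∃ τ ∈ K.faces, x ∈ τ ∧ s ⊆ τ := by
  simp only [closedStars, mem_faces_iSup]
  constructor
  · rintro ⟨x, hx, hs, τ, ⟨hτ, hxτ⟩, hsτ⟩
    exact ⟨hs, x, hx, τ, hτ, Finset.singleton_subset_iff.1 hxτ, hsτ⟩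
  · rintro ⟨hs, x, hx, τ, hτ, hxτ, hsτ⟩
    exact ⟨x, hx, hs, τ, ⟨hτ, Finset.singleton_subset_iff.2 hxτ⟩, hsτ⟩

variable [DecidableEq V]

/-! ### Cones over a subcomplex -/

/-- The point of the cone with apex `z` which divides the segment from `y` to the apex
in the ratio `t : 1 - t`. -/
noncomputable def conePoint (z : V) (y : V → ℝ) (t : ℝ) : V → ℝ :=
  fun v => (1 - t) * y v + t * (Pi.single z 1 : V → ℝ) v

theorem conePoint_mem_realization {L : PreAbstractSimplicialComplex V} {z : V}
    (hz : {z} ∉ L.faces) {y : V → ℝ} (hy : y ∈ L.realization) {t : ℝ} (ht : t ∈ Set.Icc 0 1) :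
    conePoint z y t ∈ ((point z).join L).realization := by
  obtain ⟨ht0, ht1⟩ := ht
  have hyz := apply_eq_zero_of_mem_realization hy hz
  obtain ⟨s, hs, h0, hs0, h1⟩ := hy
  have hzs : z ∉ s := fun h => hz <| (L.isRelLowerSet_faces hs).2
    (Finset.singleton_subset_iff.2 h) (Finset.singleton_nonempty z)
  refine ⟨{z} ∪ s, .inr ⟨{z}, rfl, s, hs, rfl⟩, fun v => ?_, fun v hv => ?_, ?_⟩
  · have : (0 : ℝ) ≤ (Pi.single z 1 : V → ℝ) v := by
      by_cases h : v = z <;> simp [h]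
    have := h0 v
    have : 0 ≤ 1 - t := by linarith
    unfold conePoint
    positivity
  · simp only [Finset.mem_union, Finset.mem_singleton, not_or] at hv
    simp [conePoint, hs0 v hv.2, hv.1]
  · rw [← Finset.insert_eq, Finset.sum_insert hzs]
    have : ∑ v ∈ s, conePoint z y t v = (1 - t) * ∑ v ∈ s, y v := by
      rw [Finset.mul_sum]
      refine Finset.sum_congr rfl fun v hv => ?_
      have : v ≠ z := fun h => hzs (h ▸ hv)
      simp [conePoint, this]
    rw [this, h1]
    simp [conePoint, hyz]

/-- Every point of the realized cone over a nonempty complex lies on a segment from a point of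
the base to the apex. -/
theorem exists_conePoint_eq {L : PreAbstractSimplicialComplex V} {z : V} (hz : {z} ∉ L.faces)
    (hL : L.realization.Nonempty) {f : V → ℝ} (hf : f ∈ ((point z).join L).realization) :
    ∃ y ∈ L.realization, ∃ t ∈ Set.Icc (0 : ℝ) 1, conePoint z y t = f := by
  obtain ⟨ρ, (hρ | hρ) | ⟨ρ, hρ, s, hs, rfl⟩, h0, hρ0, h1⟩ := hf
  · obtain rfl : ρ = {z} := hρ
    obtain ⟨y, hy⟩ := hL
    refine ⟨y, hy, 1, by simp, funext fun v => ?_⟩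
    by_cases h : v = z
    · subst h
      simpa [conePoint] using h1.symm
    · simp [conePoint, h, hρ0 v (by simpa using h)]
  · exact ⟨f, ⟨ρ, hρ, h0, hρ0, h1⟩, 0, by simp, funext fun v => by simp [conePoint]⟩
  · obtain rfl : ρ = {z} := hρ
    have hzs : z ∉ s := fun h => hz <| (L.isRelLowerSet_faces hs).2
      (Finset.singleton_subset_iff.2 h) (Finset.singleton_nonempty z)
    rw [← Finset.insert_eq, Finset.sum_insert hzs] at h1
    have hsum : 0 ≤ ∑ v ∈ s, f v := Finset.sum_nonneg fun v _ => h0 v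
    have hfz : f z ∈ Set.Icc (0 : ℝ) 1 := ⟨h0 z, by linarith⟩
    by_cases hz1 : f z = 1
    · obtain ⟨y, hy⟩ := hL
      refine ⟨y, hy, 1, by simp, funext fun v => ?_⟩
      by_cases h : v = z
      · subst h
        simp [conePoint, hz1]
      · have hfv : f v = 0 := by
          by_cases hv : v ∈ s
          · exact (Finset.sum_eq_zero_iff_of_nonneg fun v _ => h0 v).1 (by linarith) v hv
          · exact hρ0 v (by simp [h, hv])
        simp [conePoint, h, hfv]
    · have hpos : 0 < 1 - f z := sub_pos.2 (lt_of_le_of_ne hfz.2 hz1)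
      -- Project away from the apex: drop the coordinate at `z` and rescale.
      refine ⟨fun v => if v = z then 0 else f v / (1 - f z), ⟨s, hs, fun v => ?_, fun v hv => ?_,
        ?_⟩, f z, hfz, funext fun v => ?_⟩
      · dsimp only
        split_ifs
        · exact le_rfl
        · exact div_nonneg (h0 v) hpos.le
      · dsimp only
        split_ifs with h
        · rfl
        · rw [hρ0 v (by simp [h, hv]), zero_div]
      · have : ∀ v ∈ s, (if v = z then 0 else f v / (1 - f z)) = f v / (1 - f z) :=
          fun v hv => if_neg (ne_of_mem_of_not_mem hv hzs)
        rw [Finset.sum_congr rfl this, ← Finset.sum_div, div_eq_one_iff_eq hpos.ne']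
        linarith
      · by_cases h : v = z
        · subst h
          simp [conePoint]
        · simp only [conePoint, if_neg h, Pi.single_eq_of_ne h]
          field_simp
          ring

/-- Attaching a cone to a finite complex along a subcomplex with contractible realization
does not change the homotopy type. -/
theorem nonempty_homotopyEquiv_sup_cone {K L : PreAbstractSimplicialComplex V}
    (hK : K.faces.Finite) (hLK : L ≤ K) {z : V} (hz : {z} ∉ K.faces)
    [ContractibleSpace L.realization] :
    Nonempty (ContinuousMap.HomotopyEquiv K.realization (K ⊔ (point z).join L).realization) := by
  have hzL : {z} ∉ L.faces := fun h => hz (hLK h)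
  have := compactSpace_realization hK
  have := compactSpace_realization (hK.subset hLK)
  have hLne : L.realization.Nonempty :=
    Set.nonempty_coe_sort.1 (inferInstanceAs (Nonempty L.realization))
  have hKz : ∀ f ∈ K.realization, f z = 0 := fun f hf => apply_eq_zero_of_mem_realization hf hz
  have hle : K ≤ K ⊔ (point z).join L := le_sup_left
  have hle' : (point z).join L ≤ K ⊔ (point z).join L := le_sup_right
  have hcz : ∀ y ∈ L.realization, ∀ t, conePoint z y t z = t := fun y hy t => by
    simp [conePoint, apply_eq_zero_of_mem_realization hy hzL]
  have hcont : Continuous fun p : L.realization × I => conePoint z (p.1 : V → ℝ) (p.2 : ℝ) := by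
    refine continuous_pi fun v => ?_
    have hv : Continuous fun p : L.realization × I => (p.1 : V → ℝ) v :=
      (continuous_apply v).comp (continuous_subtype_val.comp continuous_fst)
    unfold conePoint
    fun_prop
  refine ContinuousMap.HomotopyEquiv.nonempty_of_cone_attached
    (ContinuousMap.inclusion (realization_mono hle))
    (ContinuousMap.inclusion (realization_mono hLK))
    ⟨fun p => ⟨conePoint z p.1 p.2, realization_mono hle'
      (conePoint_mem_realization hzL p.1.2 p.2.2)⟩, hcont.subtype_mk _⟩
    (Set.inclusion_injective (realization_mono hle)) (fun y => Subtype.ext ?_)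
    (fun y y' => Subtype.ext ?_) ?_ ?_ ?_
  · funext v
    simp only [ContinuousMap.coe_mk, conePoint, Set.Icc.coe_zero, sub_zero, one_mul, zero_mul,
      add_zero]
    rfl
  · funext v
    simp [conePoint]
  · rintro ⟨f, hf⟩
    rcases (realization_sup K _).subset hf with h | h
    · exact .inl ⟨⟨f, h⟩, rfl⟩
    · obtain ⟨y, hy, t, ht, rfl⟩ := exists_conePoint_eq hzL hLne h
      exact .inr ⟨(⟨y, hy⟩, ⟨t, ht⟩), rfl⟩
  · rintro ⟨k, hk⟩ ⟨y, hy⟩ t h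
    have h' : k = conePoint z y t := congrArg Subtype.val h
    refine Subtype.ext ?_
    rw [← hcz y hy t, ← h']
    exact hKz k hk
  · rintro ⟨y, hy⟩ t ⟨y', hy'⟩ t' h
    have h' : conePoint z y t = conePoint z y' t' := congrArg Subtype.val h
    obtain rfl : t = t' := Subtype.ext (by rw [← hcz y hy t, h', hcz y' hy' t'])
    refine ⟨rfl, or_iff_not_imp_left.2 fun ht => Subtype.ext (funext fun v => ?_)⟩
    have hv := congrFun h' v
    have ht' : 1 - (t : ℝ) ≠ 0 := fun h => ht (Subtype.ext (by simpa using (sub_eq_zero.1 h).symm))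
    simpa [conePoint, ht'] using hv

/-! ### Deleting dominated vertices -/

/-- The map on barycentric coordinates induced by the map of vertices which sends all of `A` to `z`
and fixes the other vertices. This is its meaning only for `z ∉ A`; for `z ∈ A` mass is lost. -/
noncomputable def collapse (A : Finset V) (z : V) (f : V → ℝ) : V → ℝ :=
  fun v => if v ∈ A then 0 else if v = z then f z + ∑ a ∈ A, f a else f v

theorem collapse_nonneg (A : Finset V) (z : V) {f : V → ℝ} (hf : ∀ v, 0 ≤ f v) (v : V) :
    0 ≤ collapse A z f v := by
  unfold collapse
  split_ifs
  · exact le_rfl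
  · exact add_nonneg (hf z) (Finset.sum_nonneg fun a _ => hf a)
  · exact hf v

theorem collapse_eq_self {A : Finset V} (z : V) {f : V → ℝ} (hf : ∀ a ∈ A, f a = 0) :
    collapse A z f = f := by
  funext v
  unfold collapse
  split_ifs with h₁ h₂
  · exact (hf v h₁).symm
  · rw [h₂, Finset.sum_eq_zero hf, add_zero]
  · rfl

/-- Collapsing `A` to `z` preserves the total mass on any set containing `z` and the support. -/
theorem sum_collapse {A : Finset V} {z : V} (hzA : z ∉ A) {f : V → ℝ} {s : Finset V} (hz : z ∈ s)
    (hf : ∀ v, v ∉ s → f v = 0) : ∑ v ∈ s, collapse A z f v = ∑ v ∈ s, f v := by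
  have hA : ∑ a ∈ A, f a = ∑ v ∈ s, if v ∈ A then f v else 0 := by
    rw [← Finset.sum_filter, Finset.filter_mem_eq_inter, Finset.inter_comm]
    exact (Finset.sum_subset Finset.inter_subset_left fun v hv h => hf v fun hs =>
      h (Finset.mem_inter.2 ⟨hv, hs⟩)).symm
  have : ∀ v, collapse A z f v =
      (f v - if v ∈ A then f v else 0) + if v = z then ∑ a ∈ A, f a else 0 := fun v => by
    unfold collapse
    by_cases h₁ : v ∈ A
    · have : v ≠ z := fun h => hzA (h ▸ h₁)
      simp [h₁, this]
    · by_cases h₂ : v = z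
      · simp [h₂, hzA]
      · simp [h₁, h₂]
  simp_rw [this]
  rw [Finset.sum_add_distrib, Finset.sum_sub_distrib, ← hA, Finset.sum_ite_eq' s z, if_pos hz]
  ring

/-- If `z` dominates the vertices in `A`, that is, adding `z` to a simplex having a vertex in `A`
gives a simplex, then deleting the vertices in `A` does not change the homotopy type. -/
theorem nonempty_homotopyEquiv_deleteVertices (K : PreAbstractSimplicialComplex V) (A : Finset V)
    {z : V} (hzA : z ∉ A) (hdom : ∀ s ∈ K.faces, (∃ a ∈ s, a ∈ A) → insert z s ∈ K.faces) :
    Nonempty (ContinuousMap.HomotopyEquiv K.realization (K.deleteVertices A).realization) := by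
  have hcont : Continuous (collapse A z : (V → ℝ) → V → ℝ) := by
    refine continuous_pi fun v => ?_
    unfold collapse
    split_ifs <;> fun_prop
  -- A point and its image lie in a common simplex.
  have common : ∀ f ∈ K.realization, ∃ s ∈ K.faces, (∀ v, 0 ≤ f v) ∧
      (∀ v, v ∉ s → f v = 0 ∧ collapse A z f v = 0) ∧
      ∑ v ∈ s, f v = 1 ∧ ∑ v ∈ s, collapse A z f v = 1 := by
    rintro f ⟨s, hs, h0, hs0, h1⟩
    by_cases h : ∃ a ∈ s, a ∈ A
    · have hs0' : ∀ v, v ∉ insert z s → f v = 0 := fun v hv =>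
        hs0 v fun h => hv (Finset.mem_insert_of_mem h)
      have h1' : ∑ v ∈ insert z s, f v = 1 := by
        rw [← h1]
        exact (Finset.sum_subset (Finset.subset_insert z s) fun v _ hv => hs0 v hv).symm
      refine ⟨insert z s, hdom s hs h, h0, fun v hv => ⟨hs0' v hv, ?_⟩, h1', ?_⟩
      · have : v ≠ z := fun h => hv (h ▸ Finset.mem_insert_self z s)
        simp [collapse, this, hs0' v hv]
      · rw [sum_collapse hzA (Finset.mem_insert_self z s) hs0', h1']
    · push Not at h
      have : collapse A z f = f := collapse_eq_self z fun a ha => hs0 a fun has => h a has ha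
      rw [this]
      exact ⟨s, hs, h0, fun v hv => ⟨hs0 v hv, hs0 v hv⟩, h1, h1⟩
  have hmem : ∀ f ∈ K.realization, collapse A z f ∈ (K.deleteVertices A).realization := by
    intro f hf
    obtain ⟨s, hs, h0, hs0, -, h1⟩ := common f hf
    have hA : ∀ v ∈ s, v ∉ s \ A → collapse A z f v = 0 := fun v hv hvA => by
      have : v ∈ A := by simpa [hv] using hvA
      simp [collapse, this]
    have h1' : ∑ v ∈ s \ A, collapse A z f v = 1 := by
      rw [← h1]
      exact Finset.sum_subset Finset.sdiff_subset hA
    refine ⟨s \ A, ⟨(K.isRelLowerSet_faces hs).2 Finset.sdiff_subset ?_, fun v hv =>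
      (Finset.mem_sdiff.1 hv).2⟩, collapse_nonneg A z h0, fun v hv => ?_, h1'⟩
    · exact Finset.nonempty_of_sum_ne_zero (h1'.trans_ne one_ne_zero)
    · by_cases hvs : v ∈ s
      · exact hA v hvs hv
      · exact (hs0 v hvs).2
  have hle : (K.deleteVertices A).realization ⊆ K.realization :=
    realization_mono fun _ h => h.1
  let i : C((K.deleteVertices A).realization, K.realization) := ContinuousMap.inclusion hle
  let r : C(K.realization, (K.deleteVertices A).realization) :=
    ⟨fun f => ⟨collapse A z f, hmem f f.2⟩, (hcont.comp continuous_subtype_val).subtype_mk _⟩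
  have hri : r.comp i = ContinuousMap.id _ := by
    ext1 ⟨f, s, ⟨hs, hsA⟩, h0, hs0, h1⟩
    exact Subtype.ext (collapse_eq_self z fun a ha => hs0 a fun has => hsA a has ha)
  refine ⟨⟨r, i, ⟨⟨⟨fun p => ⟨fun v => (1 - (p.1 : ℝ)) * collapse A z p.2 v + p.1 * p.2.1 v, ?_⟩,
    ?_⟩, ?_, ?_⟩⟩, by rw [hri]⟩⟩
  · obtain ⟨⟨t, ht0, ht1⟩, f, hf⟩ := p
    obtain ⟨s, hs, h0, hs0, h1, h1'⟩ := common f hf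
    refine ⟨s, hs, fun v => ?_, fun v hv => ?_, ?_⟩
    · exact add_nonneg (mul_nonneg (sub_nonneg.2 ht1) (collapse_nonneg A z h0 v))
        (mul_nonneg ht0 (h0 v))
    · simp [hs0 v hv]
    · rw [Finset.sum_add_distrib, ← Finset.mul_sum, ← Finset.mul_sum, h1, h1']
      ring
  · refine Continuous.subtype_mk (continuous_pi fun v => ?_) _
    have : Continuous fun p : I × K.realization => collapse A z p.2 v :=
      (continuous_apply v).comp (hcont.comp (continuous_subtype_val.comp continuous_snd))
    have : Continuous fun p : I × K.realization => (p.2 : V → ℝ) v :=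
      (continuous_apply v).comp (continuous_subtype_val.comp continuous_snd)
    fun_prop
  · rintro ⟨f, hf⟩
    refine Subtype.ext (funext fun v => ?_)
    simp only [Set.Icc.coe_zero, sub_zero, one_mul, zero_mul, add_zero]
    rfl
  · rintro ⟨f, hf⟩
    refine Subtype.ext (funext fun v => ?_)
    simp

/-- In `K ∪ (z * L)`, where `L` is the union of the stars of the vertices in `A`, the vertex `z`
dominates the vertices in `A`. -/
theorem insert_mem_faces_addCone {K : PreAbstractSimplicialComplex V} {A : Finset V} {z : V}
    (hzA : z ∉ A) {s : Finset V} (hs : s ∈ (K.addCone A z).faces) (h : ∃ a ∈ s, a ∈ A) :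
    insert z s ∈ (K.addCone A z).faces := by
  obtain ⟨a, has, haA⟩ := h
  have hL : ∀ t ∈ (K.closedStars A).faces, insert z t ∈ (K.addCone A z).faces := fun t ht =>
    .inr (.inr ⟨{z}, rfl, t, ht, Finset.insert_eq z t⟩)
  rcases hs with hs | (hs | hs) | ⟨ρ, hρ, τ, hτ, rfl⟩
  · exact hL s (mem_faces_closedStars.2 ⟨hs, a, haA, s, hs, has, subset_rfl⟩)
  · obtain rfl : s = {z} := hs
    exact absurd (Finset.mem_singleton.1 has ▸ haA) hzA
  · exact hL s hs
  · obtain rfl : ρ = {z} := hρ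
    rw [← Finset.insert_eq, Finset.insert_idem]
    exact hL τ hτ

end PreAbstractSimplicialComplex

theorem mainTheorem1 {V : Type*} [DecidableEq V]
    (K : PreAbstractSimplicialComplex V) (hK : K.faces.Finite)
    (A : Finset V) (hA : ∀ x ∈ A, {x} ∈ K.faces)
    (z : V) (hz : {z} ∉ K.faces)
    (hL : ContractibleSpace (K.closedStars A).realization) :
    Nonempty (ContinuousMap.HomotopyEquiv K.realization (K.addCone A z).realization) ∧
    Nonempty (ContinuousMap.HomotopyEquiv (K.addCone A z).realization
      ((K.addCone A z).deleteVertices A).realization) ∧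
    Nonempty (ContinuousMap.HomotopyEquiv K.realization
      ((K.addCone A z).deleteVertices A).realization) := by
  have hzA : z ∉ A := fun h => hz (hA z h)
  obtain ⟨e₁⟩ : Nonempty (ContinuousMap.HomotopyEquiv K.realization (K.addCone A z).realization) :=
    PreAbstractSimplicialComplex.nonempty_homotopyEquiv_sup_cone hK
      (fun _ h => (PreAbstractSimplicialComplex.mem_faces_closedStars.1 h).1) hz
  obtain ⟨e₂⟩ := (K.addCone A z).nonempty_homotopyEquiv_deleteVertices A hzA
    fun _ hs h => PreAbstractSimplicialComplex.insert_mem_faces_addCone hzA hs h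
  exact ⟨⟨e₁⟩, ⟨e₂⟩, ⟨e₁.trans e₂⟩⟩
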